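/- Let $S$ be a finite set (local states), let $P_0,P_1$ be transition matrices on $S$ (action $0$: idle, action $1$: activate), let $\nu:S\to\mathbb R$ be an index with pairwise distinct values, and let $\alpha\in[0,1]$. For each $N\ge 1$ such that $M=\alpha N$ is an integer, consider the $N$-agent restless multi-armed bandit: the agents are homogeneous with global kernel $P(\mathbf s'\mid \mathbf s,\mathbf a)=\prod_{i=1}^N P_{a_i}(s_i'\mid s_i)$, $\mathbf s,\mathbf s'\in S^N$, $\mathbf a\in\{0,1\}^N$, and the index policy $\pi$ activates exactly $M$ agents in descending order of $\nu_{s_i}$, ties between agents in the same state being resolved by uniform random sampling. Let $P^\pi_{1:N}(\mathbf s',\mathbf a'\mid \mathbf s,\mathbf a)=P(\mathbf s'\mid \mathbf s,\mathbf a)\,\pi(\mathbf a'\mid \mathbf s')$. Assume that $\pi$ has a unique stationary distribution $\mu$ on $S^N$, and put $\mu(\mathbf s,\mathbf a)=\mu(\mathbf s)\pi(\mathbf a\mid\mathbf s)$. *Markov entanglement.* Let $\mathcal P_{\rm SEP}$ be the set of entrywise nonnegative matrices of the form $\sum_{j=1}^K x_j P^{(j)}_1\otimes\cdots\otimes P^{(j)}_N$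 with $K\ge 1$, real (possibly negative) $x_j$ with $\sum_j x_j=1$, and transition matrices $P_i^{(j)}$ on $S\times\{0,1\}$. For an agent $i$ set $$E_i(P^\pi_{1:N})=\min_{Q\in\mathcal P_{\rm SEP}}\ \frac12\sup_{\|x\|_\infty=1}\ \sum_{\mathbf s,\mathbf a}\mu(\mathbf s,\mathbf a)\,\Big|\sum_{\mathbf s',\mathbf a'}(P^\pi_{1:N}-Q)(\mathbf s',\mathbf a'\mid \mathbf s,\mathbf a)\,x(s_i',a_i')\Big|,$$ where $x$ ranges over real functions on $S\times\{0,1\}$. *Mean-field map.* Let $\Delta$ be the probability simplex on $S$. For $m\in\Delta$ let $y_s(m)=\min\big(m_s,\max(0,\alpha-\sum_{u:\nu_u>\nu_s}m_u)\big)$ be the mass of activated agents in state $s$, and let $$\phi(m)_{s'}=\sum_{s}\big(y_s(m)P_1(s'\mid s)+(m_s-y_s(m))P_0(s'\mid s)\big);$$ this is the conditional expectation under $\pi$ of the next configuration (fractions of agents in each local state) given the current configuration $m$. Assume: (i) (uniform global attractor property) there is $m^*\in\Delta$ such that for every $\varepsilon>0$ there is $T$ with $\|\phi^{t}(m)-m^*\|_\infty<\varepsilon$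 for all $t\ge T$ and all $m\in\Delta$, where $\phi^t$ is the $t$-fold iterate; (ii) (non-degeneracy) there is a state $s$ with $m^*_s>0$ and $0<\pi^*(s,0)<1$, where $\pi^*(s,0)=1-y_s(m^*)/m^*_s$ is the probability of staying idle in state $s$ under the configuration $m^*$. Then there is a constant $C$, independent of $N$, such that for every such $N$ and every agent $i\in\{1,\dots,N\}$, $$E_i(P^\pi_{1:N})\le \frac{C}{\sqrt N}.$$ In particular the index policy is asymptotically separable: $\max_{1\le i\le N}E_i(P^\pi_{1:N})\to 0$ as $N\to\infty$ along such $N$. -/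

import Mathlib

open Matrix

noncomputable section

namespace RMAB

/-- The data shared by all agents of a (homogeneous) restless multi-armed bandit with finite local
state space `S`: the local transition matrices `P 0` (idle) and `P 1` (activate), the local
rewards `r 0`, `r 1`, and the discount factor. -/
structure RestlessBandit (S : Type*) [Fintype S] [DecidableEq S] where
  P : Fin 2 → Matrix S S ℝ
  P_stochastic : ∀ a, P a ∈ rowStochastic ℝ S
  r : Fin 2 → S → ℝ
  γ : ℝ
  γ_nonneg : 0 ≤ γ
  γ_lt_one : γ < 1

variable {S : Type*} [Fintype S] [DecidableEq S]

/-! ### The global system of `N` agents -/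

/-- A global state-action pair `(s, a)`, stored agent by agent. -/
abbrev Pair (S : Type*) (N : ℕ) : Type _ := Fin N → S × Fin 2

/-- The global state of a global state-action pair. -/
def Pair.state {S : Type*} {N : ℕ} (z : Pair S N) : Fin N → S := fun i => (z i).1

/-- The joint action of a global state-action pair. -/
def Pair.action {S : Type*} {N : ℕ} (z : Pair S N) : Fin N → Fin 2 := fun i => (z i).2

/-- The global transition kernel `P(s' | s, a) = ∏ i, P_{a i}(s' i | s i)`. -/
def RestlessBandit.kernel (B : RestlessBandit S) {N : ℕ}
    (s : Fin N → S) (a : Fin N → Fin 2) (s' : Fin N → S) : ℝ :=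
  ∏ i, B.P (a i) (s i) (s' i)

/-- The transition matrix on global state-action pairs induced by a policy `π`, where `π s a` is the
probability of the joint action `a` at the global state `s`:
`P^π(s', a' | s, a) = P(s' | s, a) π(a' | s')`. -/
def RestlessBandit.inducedMatrix (B : RestlessBandit S) {N : ℕ}
    (π : (Fin N → S) → (Fin N → Fin 2) → ℝ) : Matrix (Pair S N) (Pair S N) ℝ :=
  Matrix.of fun z z' => B.kernel z.state z.action z'.state * π z'.state z'.action

/-- `μ` is a stationary distribution of the global state under `π`. -/
def RestlessBandit.IsStationary (B : RestlessBandit S) {N : ℕ}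
    (π : (Fin N → S) → (Fin N → Fin 2) → ℝ) (μ : (Fin N → S) → ℝ) : Prop :=
  μ ∈ stdSimplex ℝ (Fin N → S) ∧
    ∀ s', ∑ s, ∑ a, μ s * π s a * B.kernel s a s' = μ s'

/-- `μ` is the unique stationary distribution of the global state under `π`. -/
def RestlessBandit.IsUniqueStationary (B : RestlessBandit S) {N : ℕ}
    (π : (Fin N → S) → (Fin N → Fin 2) → ℝ) (μ : (Fin N → S) → ℝ) : Prop :=
  B.IsStationary π μ ∧ ∀ μ', B.IsStationary π μ' → μ' = μ

/-- The occupancy measure `μ(s, a) = μ(s) π(a | s)`. -/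
def occupancy {N : ℕ} (π : (Fin N → S) → (Fin N → Fin 2) → ℝ) (μ : (Fin N → S) → ℝ) :
    Pair S N → ℝ :=
  fun z => μ z.state * π z.state z.action

/-! ### Index policies -/

open Classical in
/-- The joint actions that activate exactly `M` agents in descending order of the priority `ν`:
an idle agent never has a strictly larger index than an activated one. -/
def indexActions (ν : S → ℝ) (M : ℕ) {N : ℕ} (s : Fin N → S) : Finset (Fin N → Fin 2) :=
  Finset.univ.filter fun a =>
    (Finset.univ.filter fun i => a i = 1).card = M ∧
      ∀ i j, a i = 1 → a j = 0 → ν (s j) ≤ ν (s i)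

open Classical in
/-- The index policy with priority `ν` and budget `M`. It is the uniform distribution on
`indexActions ν M s`. When `ν` is injective, such actions differ only in which agents of the one
marginal local state are activated, so this is uniform sampling of agents at that state. -/
def indexPolicy (ν : S → ℝ) (M : ℕ) {N : ℕ} (s : Fin N → S) (a : Fin N → Fin 2) : ℝ :=
  if a ∈ indexActions ν M s then ((indexActions ν M s).card : ℝ)⁻¹ else 0

/-! ### Markov entanglement -/

/-- The tensor product `Q 1 ⊗ ⋯ ⊗ Q N` of matrices on local state-action pairs. -/
def tensor {N : ℕ} (Q : Fin N → Matrix (S × Fin 2) (S × Fin 2) ℝ) :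
    Matrix (Pair S N) (Pair S N) ℝ :=
  Matrix.of fun z z' => ∏ i, Q i (z i) (z' i)

/-- The set of separable transition matrices: entrywise nonnegative matrices that are linear
combinations, with real coefficients of sum `1` (possibly negative), of tensor products of local
transition matrices. -/
def separable (S : Type*) [Fintype S] [DecidableEq S] (N : ℕ) :
    Set (Matrix (Pair S N) (Pair S N) ℝ) :=
  {P | (∀ z z', 0 ≤ P z z') ∧
    ∃ (K : ℕ) (x : Fin K → ℝ) (Q : Fin K → Fin N → Matrix (S × Fin 2) (S × Fin 2) ℝ),
      0 < K ∧ ∑ j, x j = 1 ∧ (∀ j i, Q j i ∈ rowStochastic ℝ (S × Fin 2)) ∧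
      P = ∑ j, x j • tensor (Q j)}

/-- The `μ`-weighted seminorm `‖v‖_μ = ∑ z, μ z * |v z|`. -/
def weightedNorm {N : ℕ} (μ : Pair S N → ℝ) (v : Pair S N → ℝ) : ℝ :=
  ∑ z, μ z * |v z|

/-- The `μ`-weighted agent-wise total variation distance with respect to agent `i`:
`½ sup_{‖x‖_∞ = 1} ‖(P - P') (e ⊗ ⋯ ⊗ x ⊗ ⋯ ⊗ e)‖_μ`, with `x` in position `i`. -/
def weightedATV {N : ℕ} (μ : Pair S N → ℝ) (i : Fin N)
    (P P' : Matrix (Pair S N) (Pair S N) ℝ) : ℝ :=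
  (1 / 2) * ⨆ x : {x : S × Fin 2 → ℝ // ‖x‖ = 1},
    weightedNorm μ ((P - P') *ᵥ fun z => x.1 (z i))

/-- The measure of Markov entanglement of agent `i` with respect to the `μ`-weighted agent-wise
total variation distance. -/
def entanglement {N : ℕ} (μ : Pair S N → ℝ) (i : Fin N)
    (P : Matrix (Pair S N) (Pair S N) ℝ) : ℝ :=
  sInf (weightedATV μ i P '' separable S N)

/-! ### The mean-field dynamics -/

/-- The configuration of a global state: the fraction of agents in each local state. -/
def config {N : ℕ} (s : Fin N → S) : S → ℝ :=
  fun t => ((Finset.univ.filter fun i => s i = t).card : ℝ) / N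

open Classical in
/-- The mass of activated agents in local state `t`, when the agents have configuration `m` and a
fraction `α` of them is activated in descending order of the priority `ν`. -/
def activated (ν : S → ℝ) (α : ℝ) (m : S → ℝ) (t : S) : ℝ :=
  min (m t) (max 0 (α - ∑ u ∈ Finset.univ.filter (fun u => ν t < ν u), m u))

/-- The transition of configurations `φ^π(m) = E[m[t+1] | m[t] = m, π]` under the index policy with
priority `ν` and activation fraction `α`, on all of the simplex. The theorem
`expected_config_eq_meanFieldMap` below shows that it is this conditional expectation
for every finite number of agents. -/
def RestlessBandit.meanFieldMap (B : RestlessBandit S) (ν : S → ℝ) (α : ℝ) (m : S → ℝ) : S → ℝ :=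
  fun t => ∑ u, (activated ν α m u * B.P 1 u t + (m u - activated ν α m u) * B.P 0 u t)

/-- An action of the index policy activates `N * activated ν α (config s) t` agents in state `t`. -/
theorem card_active_eq (ν : S → ℝ) (hν : Function.Injective ν) (α : ℝ) {N M : ℕ} (hN : 0 < N)
    (hM : (M : ℝ) = α * N) (s : Fin N → S) (a : Fin N → Fin 2) (ha : a ∈ indexActions ν M s)
    (t : S) :
    ((Finset.univ.filter fun i => s i = t ∧ a i = 1).card : ℝ)
      = N * activated ν α (config s) t := by
  classical
  obtain ⟨hcard, hpr⟩ := (Finset.mem_filter.1 ha).2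
  have hN' : (0 : ℝ) < N := by exact_mod_cast hN
  set n := (Finset.univ.filter fun i => s i = t).card with hn
  set k := (Finset.univ.filter fun i => s i = t ∧ a i = 1).card with hk
  set H := (Finset.univ.filter fun i => ν t < ν (s i)).card with hH
  have hkn : k ≤ n := Finset.card_le_card fun i => by simp +contextual
  have hHsum : (∑ u ∈ Finset.univ.filter (fun u => ν t < ν u), config s u) = (H : ℝ) / N := by
    simp only [config, ← Finset.sum_div]
    congr 1
    rw [hH, Finset.card_eq_sum_card_fiberwise (f := s)
      (t := Finset.univ.filter (fun u => ν t < ν u)) (fun i hi => by simpa using hi)]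
    push_cast
    refine Finset.sum_congr rfl fun u hu => ?_
    congr 2
    ext i
    simp only [Finset.mem_filter, Finset.mem_univ, true_and] at hu ⊢
    exact ⟨fun h => ⟨h ▸ hu, h⟩, fun h => h.2⟩
  have key : k = n ∧ (n = 0 ∨ H + n ≤ M) ∨ k < n ∧ (k = 0 ∧ M ≤ H ∨ M = H + k) := by
    have h2 : ∀ i, a i ≠ 1 → a i = 0 := fun i h => by
      have := (a i).isLt
      have h3 : (a i : ℕ) ≠ 1 := fun h' => h (Fin.ext h')
      exact Fin.ext (by simp; omega)
    rcases hkn.eq_or_lt with h | h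
    · left
      refine ⟨h, ?_⟩
      rcases Nat.eq_zero_or_pos n with h0 | h0
      · exact Or.inl h0
      right
      rw [← h, hk] at h0
      obtain ⟨i, hi⟩ := Finset.card_pos.1 h0
      simp only [Finset.mem_filter, Finset.mem_univ, true_and] at hi
      rw [← h, hH, hk, ← hcard, ← Finset.card_union_of_disjoint]
      · refine Finset.card_le_card fun j hj => ?_
        simp only [Finset.mem_union, Finset.mem_filter, Finset.mem_univ, true_and] at hj ⊢
        rcases hj with hj | hj
        · by_contra hc
          have := hpr i j hi.2 (h2 j hc)
          rw [hi.1] at this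
          linarith
        · exact hj.2
      · rw [Finset.disjoint_left]
        intro j hj hj'
        simp only [Finset.mem_filter, Finset.mem_univ, true_and] at hj hj'
        rw [hj'.1] at hj
        exact lt_irrefl _ hj
    · right
      refine ⟨h, ?_⟩
      have : ∃ j, s j = t ∧ a j = 0 := by
        by_contra hc
        push Not at hc
        refine h.not_ge (Finset.card_le_card fun i hi => ?_)
        simp only [Finset.mem_filter, Finset.mem_univ, true_and] at hi ⊢
        exact ⟨hi, by by_contra h'; exact hc i hi (h2 i h')⟩
      obtain ⟨j, hj, hj0⟩ := this
      have hge : ∀ i, a i = 1 → ν t ≤ ν (s i) := fun i hi => hj ▸ hpr i j hi hj0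
      rcases Nat.eq_zero_or_pos k with h0 | h0
      · left
        refine ⟨h0, ?_⟩
        rw [← hcard]
        refine Finset.card_le_card fun i hi => ?_
        simp only [Finset.mem_filter, Finset.mem_univ, true_and] at hi ⊢
        refine lt_of_le_of_ne (hge i hi) fun he => ?_
        have := Finset.card_eq_zero.1 h0
        have hmem : i ∈ Finset.univ.filter fun i => s i = t ∧ a i = 1 := by
          simp [hi, (hν he).symm]
        rw [this] at hmem
        simp at hmem
      · right
        obtain ⟨i, hi⟩ := Finset.card_pos.1 h0
        simp only [Finset.mem_filter, Finset.mem_univ, true_and] at hi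
        rw [hH, hk, ← hcard, ← Finset.card_union_of_disjoint]
        · congr 1
          ext l
          simp only [Finset.mem_union, Finset.mem_filter, Finset.mem_univ, true_and]
          constructor
          · intro hl
            rcases (hge l hl).lt_or_eq with h' | h'
            · exact Or.inl h'
            · exact Or.inr ⟨(hν h').symm, hl⟩
          · rintro (h' | h')
            · by_contra hc
              have := hpr i l hi.2 (h2 l hc)
              rw [hi.1] at this
              linarith
            · exact h'.2
        · rw [Finset.disjoint_left]
          intro l hl hl'
          simp only [Finset.mem_filter, Finset.mem_univ, true_and] at hl hl'
          rw [hl'.1] at hl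
          exact lt_irrefl _ hl
  have hα : α = M / N := by field_simp; linarith
  have hact : N * activated ν α (config s) t = min (n : ℝ) (max 0 ((M : ℝ) - H)) := by
    rw [activated, hHsum, hα, ← sub_div, mul_min_of_nonneg _ _ hN'.le,
      mul_max_of_nonneg _ _ hN'.le, mul_zero, config, mul_div_cancel₀ _ hN'.ne',
      mul_div_cancel₀ _ hN'.ne']
  rw [hact]
  rcases key with ⟨h1, h2 | h2⟩ | ⟨h1, ⟨h2, h3⟩ | h2⟩
  · rw [h1, h2]; simp
  · have : (H : ℝ) + n ≤ M := by exact_mod_cast h2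
    rw [h1, min_eq_left]
    exact le_max_of_le_right (by linarith)
  · have : (M : ℝ) ≤ H := by exact_mod_cast h3
    rw [h2, max_eq_left (by linarith)]
    simp
  · have h3 : (M : ℝ) = H + k := by exact_mod_cast h2
    have h4 : (k : ℝ) < n := by exact_mod_cast h1
    rw [h3, add_sub_cancel_left, max_eq_right (Nat.cast_nonneg k), min_eq_right h4.le]

theorem indexActions_nonempty {S' : Type*} (ν : S' → ℝ) {N M : ℕ} (hMN : M ≤ N) (s : Fin N → S') :
    (indexActions ν M s).Nonempty := by
  classical
  set σ := Tuple.sort (fun i => - ν (s i)) with hσ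
  have hmono : Monotone ((fun i => - ν (s i)) ∘ σ) := Tuple.monotone_sort _
  refine ⟨fun i => if (σ.symm i : ℕ) < M then 1 else 0, Finset.mem_filter.2
    ⟨Finset.mem_univ _, ?_, ?_⟩⟩
  · have : (Finset.univ.filter fun i : Fin N =>
        (if (σ.symm i : ℕ) < M then (1 : Fin 2) else 0) = 1)
        = (Finset.univ.filter fun i : Fin N => (i : ℕ) < M).map σ.toEmbedding := by
      ext i
      simp [Finset.mem_map_equiv]
    rw [this, Finset.card_map, Fin.card_filter_val_lt]
    simp [hMN]
  · intro i j hi hj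
    have hi' : (σ.symm i : ℕ) < M := by by_contra h; simp [h] at hi
    have hj' : ¬ (σ.symm j : ℕ) < M := by intro h; simp [h] at hj
    have := hmono (show σ.symm i ≤ σ.symm j from Fin.le_def.2 (by omega))
    simpa using this

theorem sum_indexPolicy {S' : Type*} (ν : S' → ℝ) {N M : ℕ} (hMN : M ≤ N) (s : Fin N → S') :
    ∑ a, indexPolicy ν M s a = 1 := by
  classical
  have := (indexActions_nonempty ν hMN s).card_pos
  simp only [indexPolicy]
  rw [Finset.sum_ite_mem]
  simp only [Finset.univ_inter, Finset.sum_const, nsmul_eq_mul]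
  exact mul_inv_cancel₀ (by positivity)

theorem sum_kernel_config (B : RestlessBandit S) {N : ℕ} (s : Fin N → S) (a : Fin N → Fin 2)
    (t : S) : ∑ s', B.kernel s a s' * config s' t = (∑ i, B.P (a i) (s i) t) / N := by
  classical
  have h1 : ∀ i, ∑ s' : Fin N → S, B.kernel s a s' * (if s' i = t then 1 else 0)
      = B.P (a i) (s i) t := by
    intro i
    have h2 : ∀ s' : Fin N → S, B.kernel s a s' * (if s' i = t then 1 else 0)
        = ∏ j, B.P (a j) (s j) (s' j) * (if j = i then (if s' j = t then 1 else 0) else 1) := by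
      intro s'
      rw [Finset.prod_mul_distrib, RestlessBandit.kernel, Finset.prod_ite_eq']
      simp
    rw [Finset.sum_congr rfl fun s' _ => h2 s', ← Fintype.piFinset_univ, ← Finset.prod_univ_sum
      (f := fun j u => B.P (a j) (s j) u * (if j = i then (if u = t then 1 else 0) else 1)),
      Finset.prod_eq_single i]
    · simp
    · intro j _ hj
      simp [hj, sum_row_of_mem_rowStochastic (B.P_stochastic (a j)) (s j)]
    · simp
  have h3 : ∀ s' : Fin N → S, B.kernel s a s' * config s' t
      = (∑ i, B.kernel s a s' * (if s' i = t then 1 else 0)) / N := by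
    intro s'
    rw [config, Finset.card_filter, ← Finset.mul_sum]
    push_cast
    ring
  simp only [h3]
  rw [← Finset.sum_div, Finset.sum_comm]
  simp only [h1]

/-- For every finite number `N` of agents of which `M = α N` are activated, `φ^π` is the conditional
expectation of the next configuration given the current global state. -/
theorem expected_config_eq_meanFieldMap (B : RestlessBandit S) (ν : S → ℝ)
    (hν : Function.Injective ν) (α : ℝ) {N M : ℕ} (hN : 0 < N) (hMN : M ≤ N)
    (hM : (M : ℝ) = α * N) (s : Fin N → S) (t : S) :
    ∑ a, indexPolicy ν M s a * ∑ s', B.kernel s a s' * config s' t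
      = B.meanFieldMap ν α (config s) t := by
  classical
  have hN' : (N : ℝ) ≠ 0 := by positivity
  have h : ∀ a, indexPolicy ν M s a * ∑ s', B.kernel s a s' * config s' t
      = indexPolicy ν M s a * B.meanFieldMap ν α (config s) t := by
    intro a
    by_cases ha : a ∈ indexActions ν M s
    · congr 1
      rw [sum_kernel_config, div_eq_iff hN', RestlessBandit.meanFieldMap, Finset.sum_mul,
        ← Finset.sum_fiberwise Finset.univ s]
      refine Finset.sum_congr rfl fun u _ => ?_
      have hk := card_active_eq ν hν α hN hM s a ha u
      have hn : ((Finset.univ.filter fun i => s i = u).card : ℝ) = N * config s u := by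
        rw [config, mul_div_cancel₀ _ hN']
      rw [← Finset.sum_filter_add_sum_filter_not _ (fun i => a i = 1)]
      have hsplit := Finset.card_filter_add_card_filter_not
        (s := Finset.univ.filter fun i => s i = u) (fun i => a i = 1)
      rw [Finset.filter_filter] at hsplit
      have h0 : (((Finset.univ.filter fun i => s i = u).filter fun i => ¬ a i = 1).card : ℝ)
          = N * (config s u - activated ν α (config s) u) := by
        rw [mul_sub, ← hk, ← hn, ← hsplit]
        push_cast
        ring
      rw [Finset.sum_congr rfl (g := fun _ => B.P 1 u t), Finset.sum_const, nsmul_eq_mul,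
        Finset.filter_filter, hk, Finset.sum_congr rfl (g := fun _ => B.P 0 u t),
        Finset.sum_const, nsmul_eq_mul, h0]
      · ring
      · intro i hi
        simp only [Finset.mem_filter, Finset.mem_univ, true_and] at hi
        have : a i = 0 := by
          have h4 := (a i).isLt
          have h3 : (a i : ℕ) ≠ 1 := fun h' => hi.2 (Fin.ext h')
          exact Fin.ext (by simp; omega)
        rw [this, hi.1]
      · intro i hi
        simp only [Finset.mem_filter, Finset.mem_univ, true_and] at hi
        rw [hi.1, hi.2]
    · simp [indexPolicy, ha]
  simp only [h]
  rw [← Finset.sum_mul, sum_indexPolicy ν hMN s, one_mul]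

/-- The local policy under the configuration `m`: the probability that an agent in local state `t`
takes action `a`. (Where `m t = 0` there is no agent in state `t`, and the value is
`0` or `1`.) -/
def localPolicy (ν : S → ℝ) (α : ℝ) (m : S → ℝ) (t : S) (a : Fin 2) : ℝ :=
  if a = 1 then activated ν α m t / m t else 1 - activated ν α m t / m t

/-- `m'` is a uniform global attractor of the self-map `φ` of the simplex. -/
def IsUniformGlobalAttractor (φ : (S → ℝ) → S → ℝ) (m' : S → ℝ) : Prop :=
  m' ∈ stdSimplex ℝ S ∧
    ∀ ε : ℝ, 0 < ε → ∃ T : ℕ, ∀ t ≥ T, ∀ m ∈ stdSimplex ℝ S, ‖φ^[t] m - m'‖ < ε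

/-- Non-degeneracy at `m'`: some local state is randomized by the local policy under `m'`. -/
def NonDegenerate (ν : S → ℝ) (α : ℝ) (m' : S → ℝ) : Prop :=
  ∃ t, 0 < localPolicy ν α m' t 0 ∧ localPolicy ν α m' t 0 < 1

end RMAB

end

open Matrix

noncomputable section

namespace RMAB

variable {S : Type*} [Fintype S] [DecidableEq S]

set_option linter.unusedSectionVars false

/-! ### The mean-field map -/

/-! The entanglement is bounded by testing one separable matrix: the `N`-fold tensor power of the
chain of a single agent that follows the local policy under `mstar`. Applied to a function of agent
`i` alone, the difference of the two matrices sees only the law of that agent's next action, which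
is the local policy under the next configuration against the local policy under `mstar`.
Stationarity turns the next state into a state drawn from `μ`, and exchangeability (from uniqueness
of `μ`) replaces the state of agent `i` by a state drawn from the configuration. The error is then a
mean of `m t * |p_m t - p_mstar t|`, with `p_m t` the activation probability in state `t` under `m`.
It is Lipschitz in `m`, so the entanglement is at most a constant times the stationary mean of
`‖config s - mstar‖` (`entanglement_indexPolicy_le`).

That mean is `O(1 / √N)` (`exists_stationary_mean_norm_config_sub_le`). Given the present state and
action the agents move independently, so a variance bound puts the next configuration within `O(1 /
√N)` of the mean-field map `φ`. If `φ^[T]` halves distances to `mstar`, comparing `T` steps of the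
stationary chain with `φ^[T]` bounds the mean by half of itself plus `O(1 / √N)`.

The halving (`exists_iterate_contracting`) is where the two hypotheses meet. Non-degeneracy makes
`φ` affine near `mstar`; the attractor property keeps orbits from a small ball in the affine region
and makes all points uniformly close to `mstar` at a common time. Scaling along rays turns this
closeness into a linear contraction estimate. -/

theorem activated_nonneg (ν : S → ℝ) (α : ℝ) {m : S → ℝ} {t : S} (hm : 0 ≤ m t) :
    0 ≤ activated ν α m t :=
  le_min hm (le_max_left _ _)

theorem activated_le (ν : S → ℝ) (α : ℝ) (m : S → ℝ) (t : S) : activated ν α m t ≤ m t :=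
  min_le_left _ _

/-- `min` and `max` do not increase distances, and the mass above `t` is a sum of at most `card S`
coordinates. -/
theorem abs_activated_sub_le (ν : S → ℝ) (α : ℝ) (m m' : S → ℝ) (t : S) :
    |activated ν α m t - activated ν α m' t| ≤ Fintype.card S * ‖m - m'‖ := by
  classical
  have hd : ∀ u, |m u - m' u| ≤ ‖m - m'‖ := fun u => norm_le_pi_norm (m - m') u
  have hc : (1 : ℝ) ≤ Fintype.card S := by
    exact_mod_cast Fintype.card_pos_iff.2 ⟨t⟩
  have h0 := norm_nonneg (m - m')
  refine (abs_min_sub_min_le_max _ _ _ _).trans (max_le ((hd t).trans ?_) ?_)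
  · nlinarith
  · refine (abs_max_sub_max_le_max _ _ _ _).trans (max_le (by simp; positivity) ?_)
    rw [sub_sub_sub_cancel_left, ← Finset.sum_sub_distrib]
    refine (Finset.abs_sum_le_sum_abs _ _).trans ?_
    refine (Finset.sum_le_card_nsmul _ _ ‖m - m'‖ fun u _ => ?_).trans ?_
    · rw [abs_sub_comm]; exact hd u
    · rw [nsmul_eq_mul]
      gcongr
      exact Finset.card_le_univ _

/-- Per state, the active mass contributes `card S` and the idle mass `card S + 1`. What matters is
that the constant does not depend on `N`. -/
theorem RestlessBandit.norm_meanFieldMap_sub_le (B : RestlessBandit S) (ν : S → ℝ) (α : ℝ)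
    (m m' : S → ℝ) :
    ‖B.meanFieldMap ν α m - B.meanFieldMap ν α m'‖
      ≤ (Fintype.card S * (2 * Fintype.card S + 1)) * ‖m - m'‖ := by
  rw [pi_norm_le_iff_of_nonneg (by positivity)]
  intro t
  rw [Pi.sub_apply, meanFieldMap, meanFieldMap, ← Finset.sum_sub_distrib, Real.norm_eq_abs]
  refine (Finset.abs_sum_le_sum_abs _ _).trans ?_
  refine (Finset.sum_le_card_nsmul _ _ ((2 * Fintype.card S + 1) * ‖m - m'‖)
    fun u _ => ?_).trans ?_
  · have hd : |m u - m' u| ≤ ‖m - m'‖ := norm_le_pi_norm (m - m') u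
    have hy := abs_activated_sub_le ν α m m' u
    have hp : ∀ a, |B.P a u t| ≤ 1 := fun a => by
      rw [abs_of_nonneg (nonneg_of_mem_rowStochastic (B.P_stochastic a))]
      exact le_one_of_mem_rowStochastic (B.P_stochastic a)
    have hw : |m u - m' u - (activated ν α m u - activated ν α m' u)|
        ≤ (Fintype.card S + 1) * ‖m - m'‖ := (abs_sub _ _).trans (by linarith)
    calc _ = |(activated ν α m u - activated ν α m' u) * B.P 1 u t
          + (m u - m' u - (activated ν α m u - activated ν α m' u)) * B.P 0 u t| := by
            congr 1; ring
      _ ≤ |activated ν α m u - activated ν α m' u| * |B.P 1 u t|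
          + |m u - m' u - (activated ν α m u - activated ν α m' u)| * |B.P 0 u t| := by
            rw [← abs_mul, ← abs_mul]; exact abs_add_le _ _
      _ ≤ (Fintype.card S * ‖m - m'‖) * 1 + ((Fintype.card S + 1) * ‖m - m'‖) * 1 := by
            gcongr <;> exact hp _
      _ = _ := by ring
  · rw [nsmul_eq_mul, Finset.card_univ, mul_assoc]

theorem RestlessBandit.continuous_meanFieldMap (B : RestlessBandit S) (ν : S → ℝ) (α : ℝ) :
    Continuous (B.meanFieldMap ν α) := by
  unfold meanFieldMap activated
  fun_prop

theorem RestlessBandit.meanFieldMap_mem_stdSimplex (B : RestlessBandit S) (ν : S → ℝ) (α : ℝ)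
    {m : S → ℝ} (hm : m ∈ stdSimplex ℝ S) : B.meanFieldMap ν α m ∈ stdSimplex ℝ S := by
  refine ⟨fun t => Finset.sum_nonneg fun u _ => ?_, ?_⟩
  · have h1 := activated_nonneg ν α (hm.1 u)
    have h2 := activated_le ν α m u
    have := fun a => nonneg_of_mem_rowStochastic (B.P_stochastic a) (i := u) (j := t)
    exact add_nonneg (mul_nonneg h1 (this 1)) (mul_nonneg (sub_nonneg.2 h2) (this 0))
  · unfold meanFieldMap
    rw [Finset.sum_comm, ← hm.2]
    refine Finset.sum_congr rfl fun u _ => ?_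
    rw [Finset.sum_add_distrib, ← Finset.mul_sum, ← Finset.mul_sum,
      sum_row_of_mem_rowStochastic (B.P_stochastic 1), sum_row_of_mem_rowStochastic (B.P_stochastic 0)]
    ring

theorem RestlessBandit.iterate_meanFieldMap_mem_stdSimplex (B : RestlessBandit S) (ν : S → ℝ)
    (α : ℝ) {m : S → ℝ} (hm : m ∈ stdSimplex ℝ S) (t : ℕ) :
    (B.meanFieldMap ν α)^[t] m ∈ stdSimplex ℝ S := by
  induction t with
  | zero => exact hm
  | succ t ih =>
    rw [Function.iterate_succ_apply']
    exact B.meanFieldMap_mem_stdSimplex ν α ih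

/-- A uniform global attractor of a continuous self-map of the simplex is a fixed point. -/
theorem IsUniformGlobalAttractor.isFixedPt {φ : (S → ℝ) → S → ℝ} {m' : S → ℝ}
    (h : IsUniformGlobalAttractor φ m') (hφ : Continuous φ) : φ m' = m' := by
  have ht : Filter.Tendsto (fun t => φ^[t] m') Filter.atTop (nhds m') := by
    rw [Metric.tendsto_atTop]
    intro ε hε
    obtain ⟨T, hT⟩ := h.2 ε hε
    exact ⟨T, fun t h' => by rw [dist_eq_norm]; exact hT t h' m' h.1⟩
  exact isFixedPt_of_tendsto_iterate ht hφ.continuousAt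

open Classical in
/-- The configurations at which `t` is the marginal state, randomized by the index policy. -/
def marginalSet (ν : S → ℝ) (α : ℝ) (t : S) : Set (S → ℝ) :=
  {m | 0 < α - ∑ u ∈ Finset.univ.filter (fun u => ν t < ν u), m u ∧
    α - ∑ u ∈ Finset.univ.filter (fun u => ν t < ν u), m u < m t}

theorem isOpen_marginalSet (ν : S → ℝ) (α : ℝ) (t : S) : IsOpen (marginalSet ν α t) := by
  classical
  exact (isOpen_lt (f := fun _ => (0 : ℝ))
      (g := fun m : S → ℝ => α - ∑ u ∈ Finset.univ.filter (fun u => ν t < ν u), m u)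
      (by fun_prop) (by fun_prop)).inter
    (isOpen_lt (f := fun m : S → ℝ => α - ∑ u ∈ Finset.univ.filter (fun u => ν t < ν u), m u)
      (g := fun m => m t) (by fun_prop) (by fun_prop))

theorem NonDegenerate.exists_mem_marginalSet {ν : S → ℝ} {α : ℝ} {m : S → ℝ}
    (h : NonDegenerate ν α m) (hm : m ∈ stdSimplex ℝ S) : ∃ t, m ∈ marginalSet ν α t := by
  classical
  obtain ⟨t, h0, h1⟩ := h
  refine ⟨t, ?_⟩
  simp only [localPolicy, Fin.isValue, zero_ne_one, if_false] at h0 h1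
  -- At `m t = 0` the quotient is `0` by convention, so the idle probability is `1`, against `h1`.
  have hmt : 0 < m t := by
    refine lt_of_le_of_ne (hm.1 t) fun h => ?_
    rw [← h] at h1
    simp at h1
  have hy0 : 0 < activated ν α m t := by
    by_contra hc
    have := div_nonpos_of_nonpos_of_nonneg (not_lt.1 hc) hmt.le
    linarith
  have hy1 : activated ν α m t < m t := by
    have : activated ν α m t / m t < 1 := by linarith
    rwa [div_lt_one hmt] at this
  unfold activated at hy0 hy1
  constructor
  · have := (lt_min_iff.1 hy0).2
    rcases lt_max_iff.1 this with h | h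
    · exact absurd h (lt_irrefl _)
    · convert h
  · rcases min_lt_iff.1 hy1 with h | h
    · exact absurd h (lt_irrefl _)
    · convert (max_lt_iff.1 h).2

-- The budget runs out inside `t`: states above `t` are fully activated, states below are idle, and
-- `t` receives the remainder. Injectivity of `ν` excludes ties.
open Classical in
theorem activated_of_mem_marginalSet {ν : S → ℝ} (hν : Function.Injective ν) {α : ℝ} {t : S}
    {m : S → ℝ} (hm : m ∈ stdSimplex ℝ S) (h : m ∈ marginalSet ν α t) (u : S) :
    activated ν α m u = if u = t then α - ∑ u ∈ Finset.univ.filter (fun u => ν t < ν u), m u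
      else if ν t < ν u then m u else 0 := by
  obtain ⟨h1, h2⟩ := h
  unfold activated
  split_ifs with hut hlt
  · subst hut
    rw [max_eq_right h1.le, min_eq_right h2.le]
  · refine min_eq_left (le_max_of_le_right ?_)
    -- The state `u` and all states above it lie above `t`, so the budget left at `u` covers `m u`.
    have : m u + ∑ w ∈ Finset.univ.filter (fun w => ν u < ν w), m w
        ≤ ∑ w ∈ Finset.univ.filter (fun w => ν t < ν w), m w := by
      rw [← Finset.sum_insert (by simp)]
      refine Finset.sum_le_sum_of_subset_of_nonneg (fun w hw => ?_) fun w _ _ => hm.1 w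
      simp only [Finset.mem_insert, Finset.mem_filter, Finset.mem_univ, true_and] at hw ⊢
      rcases hw with rfl | hw
      · exact hlt
      · exact hlt.trans hw
    linarith
  · have hlt' : ν u < ν t := lt_of_le_of_ne (not_lt.1 hlt) fun h => hut (hν h)
    -- The state `t` and the states above it already exceed the budget and all precede `u`.
    have : m t + ∑ w ∈ Finset.univ.filter (fun w => ν t < ν w), m w
        ≤ ∑ w ∈ Finset.univ.filter (fun w => ν u < ν w), m w := by
      rw [← Finset.sum_insert (by simp)]
      refine Finset.sum_le_sum_of_subset_of_nonneg (fun w hw => ?_) fun w _ _ => hm.1 w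
      simp only [Finset.mem_insert, Finset.mem_filter, Finset.mem_univ, true_and] at hw ⊢
      rcases hw with rfl | hw
      · exact hlt'
      · exact hlt'.trans hw
    rw [max_eq_left (by linarith), min_eq_right (hm.1 u)]

/-- On the set where `t` is the marginal state the mean-field map is affine, hence homogeneous
along rays. -/
theorem RestlessBandit.meanFieldMap_sub_eq_smul (B : RestlessBandit S) {ν : S → ℝ}
    (hν : Function.Injective ν) {α : ℝ} {t : S} {m₀ m m' : S → ℝ} (c : ℝ)
    (hm₀ : m₀ ∈ stdSimplex ℝ S ∩ marginalSet ν α t)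
    (hm : m ∈ stdSimplex ℝ S ∩ marginalSet ν α t)
    (hm' : m' ∈ stdSimplex ℝ S ∩ marginalSet ν α t) (h : m' - m₀ = c • (m - m₀)) :
    B.meanFieldMap ν α m' - B.meanFieldMap ν α m₀
      = c • (B.meanFieldMap ν α m - B.meanFieldMap ν α m₀) := by
  classical
  have hu : ∀ u, m' u - m₀ u = c * (m u - m₀ u) := fun u => congrFun h u
  have hy : ∀ u, activated ν α m' u - activated ν α m₀ u
      = c * (activated ν α m u - activated ν α m₀ u) := by
    intro u
    rw [activated_of_mem_marginalSet hν hm₀.1 hm₀.2, activated_of_mem_marginalSet hν hm.1 hm.2,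
      activated_of_mem_marginalSet hν hm'.1 hm'.2]
    split_ifs
    · rw [sub_sub_sub_cancel_left, sub_sub_sub_cancel_left, ← Finset.sum_sub_distrib,
        ← Finset.sum_sub_distrib, Finset.mul_sum]
      refine Finset.sum_congr rfl fun w _ => ?_
      linarith [hu w]
    · exact hu u
    · simp
  ext x
  simp only [Pi.sub_apply, Pi.smul_apply, smul_eq_mul, meanFieldMap]
  rw [← Finset.sum_sub_distrib, ← Finset.sum_sub_distrib, Finset.mul_sum]
  refine Finset.sum_congr rfl fun u _ => ?_
  linear_combination (B.P 1 u x - B.P 0 u x) * hy u + B.P 0 u x * hu u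

/-- A point of the simplex can be moved along its ray from `m₀` up to a fixed distance from `m₀`
without leaving the simplex. -/
theorem exists_radius_stdSimplex {m₀ : S → ℝ} (hm₀ : m₀ ∈ stdSimplex ℝ S) :
    ∃ κ : ℝ, 0 < κ ∧ ∀ m ∈ stdSimplex ℝ S, ∀ c : ℝ, 0 ≤ c → c * ‖m - m₀‖ ≤ κ →
      m₀ + c • (m - m₀) ∈ stdSimplex ℝ S := by
  have hne : (Finset.univ.filter fun s => 0 < m₀ s).Nonempty := by
    by_contra hc
    rw [Finset.not_nonempty_iff_eq_empty, Finset.filter_eq_empty_iff] at hc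
    have : ∑ s, m₀ s ≤ 0 := Finset.sum_nonpos fun s _ => not_lt.1 (hc (Finset.mem_univ s))
    linarith [hm₀.2]
  -- The radius is the least positive coordinate of `m₀`. Where `m₀` vanishes, the displacement is
  -- nonnegative and imposes no bound on `c`.
  obtain ⟨s₀, hs₀, hmin⟩ := Finset.exists_min_image _ m₀ hne
  refine ⟨m₀ s₀, (Finset.mem_filter.1 hs₀).2, fun m hm c hc hle => ⟨fun s => ?_, ?_⟩⟩
  · simp only [Pi.add_apply, Pi.smul_apply, Pi.sub_apply, smul_eq_mul]
    rcases (hm₀.1 s).eq_or_lt with h | h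
    · rw [← h]
      have := mul_nonneg hc (hm.1 s)
      simpa using this
    · have h1 := hmin s (by simpa using h)
      have h2 : |m s - m₀ s| ≤ ‖m - m₀‖ := norm_le_pi_norm (m - m₀) s
      have h3 := mul_le_mul_of_nonneg_left ((abs_le.1 h2).1) hc
      linarith
  · simp only [Pi.add_apply, Pi.smul_apply, Pi.sub_apply, smul_eq_mul]
    rw [Finset.sum_add_distrib, ← Finset.mul_sum, Finset.sum_sub_distrib, hm.2, hm₀.2]
    ring

/-- Under the uniform global attractor property and non-degeneracy, some iterate of the mean-field
map contracts the distance to the attractor by a factor `1 / 2`, on all of the simplex. -/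
theorem RestlessBandit.exists_iterate_contracting (B : RestlessBandit S) {ν : S → ℝ}
    (hν : Function.Injective ν) {α : ℝ} {mstar : S → ℝ}
    (hU : IsUniformGlobalAttractor (B.meanFieldMap ν α) mstar) (hnd : NonDegenerate ν α mstar) :
    ∃ T : ℕ, ∀ m ∈ stdSimplex ℝ S,
      ‖(B.meanFieldMap ν α)^[T] m - mstar‖ ≤ 1 / 2 * ‖m - mstar‖ := by
  set φ := B.meanFieldMap ν α with hφ
  have hcont : Continuous φ := B.continuous_meanFieldMap ν α
  have hfix : φ mstar = mstar := hU.isFixedPt hcont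
  obtain ⟨t, ht⟩ := hnd.exists_mem_marginalSet hU.1
  set U := marginalSet ν α t with hUdef
  -- Orbits from a `δ`-ball never leave `U`: from time `T₀` on by the uniform attractor property,
  -- and at the finitely many earlier times by continuity of the iterates at the fixed point.
  obtain ⟨ε, hε, hball⟩ := Metric.isOpen_iff.1 (isOpen_marginalSet ν α t) mstar ht
  obtain ⟨T₀, hT₀⟩ := hU.2 ε hε
  have hmem : ∀ᶠ m in nhds mstar, ∀ k ∈ Finset.range T₀, φ^[k] m ∈ U := by
    rw [Filter.eventually_all_finset]
    intro k _
    refine (hcont.iterate k).continuousAt.eventually_mem ?_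
    rw [Function.iterate_fixed hfix]
    exact (isOpen_marginalSet ν α t).mem_nhds ht
  obtain ⟨δ, hδ, hW⟩ := Metric.eventually_nhds_iff.1 hmem
  have hstay : ∀ m ∈ stdSimplex ℝ S, ‖m - mstar‖ < δ → ∀ k, φ^[k] m ∈ stdSimplex ℝ S ∩ U := by
    intro m hm hd k
    refine ⟨B.iterate_meanFieldMap_mem_stdSimplex ν α hm k, ?_⟩
    rcases lt_or_ge k T₀ with hk | hk
    · exact hW (by rwa [dist_eq_norm]) k (Finset.mem_range.2 hk)
    · exact hball (by rw [Metric.mem_ball, dist_eq_norm]; exact hT₀ k hk m hm)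
  obtain ⟨κ, hκ, hray⟩ := exists_radius_stdSimplex hU.1
  -- `η ≤ κ` allows rays to be prolonged to distance `η` inside the simplex; `η < δ` keeps the
  -- prolonged point in the region where orbits stay in `U`.
  set η := min κ (δ / 2) with hη
  have hη0 : 0 < η := lt_min hκ (half_pos hδ)
  have hηδ : η < δ := (min_le_right _ _).trans_lt (half_lt_self hδ)
  -- This single `T` settles points at distance at least `η` directly; nearer points are rescaled to
  -- distance exactly `η`.
  obtain ⟨T, hT⟩ := hU.2 (η / 2) (half_pos hη0)
  refine ⟨T, fun m hm => ?_⟩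
  rcases le_or_gt η ‖m - mstar‖ with hfar | hnear
  · have := hT T le_rfl m hm
    linarith
  rcases (norm_nonneg (m - mstar)).eq_or_lt with h0 | hpos
  · have : m = mstar := sub_eq_zero.1 (norm_eq_zero.1 h0.symm)
    rw [this, Function.iterate_fixed hfix]
    simp
  set c := η / ‖m - mstar‖ with hc
  have hc0 : 0 < c := div_pos hη0 hpos
  have hcn : c * ‖m - mstar‖ = η := div_mul_cancel₀ _ hpos.ne'
  have hm' := hray m hm c hc0.le (hcn.le.trans (min_le_left _ _))
  set m' := mstar + c • (m - mstar) with hm'def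
  have hsub : m' - mstar = c • (m - mstar) := add_sub_cancel_left _ _
  have hnorm' : ‖m' - mstar‖ < δ := by
    rw [hsub, norm_smul, Real.norm_of_nonneg hc0.le, hcn]
    exact hηδ
  -- Both orbits stay in the affine region, so scaling about `mstar` commutes with every iterate;
  -- the bound `η / 2` at `m'` then scales back to `m`.
  have hit : ∀ k, φ^[k] m' - mstar = c • (φ^[k] m - mstar) := by
    intro k
    induction k with
    | zero => exact hsub
    | succ k ih =>
      have := B.meanFieldMap_sub_eq_smul hν c ⟨hU.1, ht⟩ (hstay m hm (hnear.trans hηδ) k)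
        (hstay m' hm' hnorm' k) ih
      rw [← hφ, hfix] at this
      rw [Function.iterate_succ_apply', Function.iterate_succ_apply', this]
  have h1 := hT T le_rfl m' hm'
  rw [hit, norm_smul, Real.norm_of_nonneg hc0.le] at h1
  have h2 : c * ‖φ^[T] m - mstar‖ ≤ c * (1 / 2 * ‖m - mstar‖) := by linarith
  exact le_of_mul_le_mul_left h2 hc0

/-! ### Sums over product distributions -/

/-- Fubini for product weights. Taking `h` equal to `1` off one or two coordinates yields marginals
and covariances. -/
theorem sum_prod_mul_prod {ι κ : Type*} [Fintype ι] [DecidableEq ι] [Fintype κ]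
    (p h : ι → κ → ℝ) :
    ∑ x : ι → κ, (∏ i, p i (x i)) * ∏ i, h i (x i) = ∏ i, ∑ u, p i u * h i u := by
  classical
  simp only [← Finset.prod_mul_distrib]
  rw [Finset.prod_univ_sum, Fintype.piFinset_univ]

theorem sum_prod_mul_apply {ι κ : Type*} [Fintype ι] [DecidableEq ι] [Fintype κ]
    {p : ι → κ → ℝ} (hp : ∀ i, ∑ u, p i u = 1) (i : ι) (g : κ → ℝ) :
    ∑ x : ι → κ, (∏ j, p j (x j)) * g (x i) = ∑ u, p i u * g u := by
  have h := sum_prod_mul_prod p (fun j u => if j = i then g u else 1)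
  simp only [Finset.prod_ite_eq', Finset.mem_univ, if_true] at h
  rw [h, Finset.prod_eq_single i]
  · simp
  · intro j _ hj
    simp [hj, hp]
  · simp

theorem sum_prod_mul_apply_mul_apply {ι κ : Type*} [Fintype ι] [DecidableEq ι] [Fintype κ]
    {p f : ι → κ → ℝ} (hf : ∀ i, ∑ u, p i u * f i u = 0) {i j : ι} (hij : i ≠ j) :
    ∑ x : ι → κ, (∏ k, p k (x k)) * (f i (x i) * f j (x j)) = 0 := by
  have h := sum_prod_mul_prod p
    (fun k u => (if k = i then f i u else 1) * (if k = j then f j u else 1))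
  simp only [Finset.prod_mul_distrib, Finset.prod_ite_eq', Finset.mem_univ, if_true] at h
  rw [h, Finset.prod_eq_zero (Finset.mem_univ i)]
  simp [hij, hf]

/-- The variance of a sum of `n` independent centered variables bounded by `1` is at most `n`. -/
theorem sum_prod_mul_sq_le {ι κ : Type*} [Fintype ι] [DecidableEq ι] [Fintype κ]
    {p f : ι → κ → ℝ} (hp0 : ∀ i u, 0 ≤ p i u) (hp : ∀ i, ∑ u, p i u = 1)
    (hf : ∀ i, ∑ u, p i u * f i u = 0) (hf1 : ∀ i u, f i u ^ 2 ≤ 1) :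
    ∑ x : ι → κ, (∏ k, p k (x k)) * (∑ i, f i (x i)) ^ 2 ≤ Fintype.card ι := by
  have h1 : ∀ x : ι → κ, (∏ k, p k (x k)) * (∑ i, f i (x i)) ^ 2
      = ∑ i, ∑ j, (∏ k, p k (x k)) * (f i (x i) * f j (x j)) := fun x => by
    rw [sq, Finset.sum_mul_sum, Finset.mul_sum]
    simp only [Finset.mul_sum]
  simp only [h1]
  rw [Finset.sum_comm]
  refine (Finset.sum_le_card_nsmul _ _ 1 fun i _ => ?_).trans (by simp)
  rw [Finset.sum_comm, Finset.sum_eq_single i]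
  · have := sum_prod_mul_apply hp i (fun u => f i u * f i u)
    rw [this, ← hp i]
    refine Finset.sum_le_sum fun u _ => ?_
    have := mul_le_mul_of_nonneg_left (hf1 i u) (hp0 i u)
    linarith
  · intro j _ hj
    exact sum_prod_mul_apply_mul_apply hf hj.symm
  · simp

/-! ### Fluctuations of the configuration in one step -/

theorem RestlessBandit.kernel_nonneg (B : RestlessBandit S) {N : ℕ} (s : Fin N → S)
    (a : Fin N → Fin 2) (s' : Fin N → S) : 0 ≤ B.kernel s a s' :=
  Finset.prod_nonneg fun i _ => nonneg_of_mem_rowStochastic (B.P_stochastic (a i))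

theorem RestlessBandit.sum_kernel (B : RestlessBandit S) {N : ℕ} (s : Fin N → S)
    (a : Fin N → Fin 2) : ∑ s', B.kernel s a s' = 1 := by
  have := sum_prod_mul_prod (fun i u => B.P (a i) (s i) u) (fun _ _ => 1)
  simpa [kernel, sum_row_of_mem_rowStochastic (B.P_stochastic _)] using this

theorem card_state_eq {N : ℕ} (hN : 0 < N) (s : Fin N → S) (t : S) :
    ((Finset.univ.filter fun i => s i = t).card : ℝ) = N * config s t := by
  rw [config, mul_div_cancel₀]
  exact_mod_cast hN.ne'

theorem config_mem_stdSimplex {N : ℕ} (hN : 0 < N) (s : Fin N → S) :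
    config s ∈ stdSimplex ℝ S := by
  refine ⟨fun t => by unfold config; positivity, ?_⟩
  simp only [config, ← Finset.sum_div]
  rw [div_eq_one_iff_eq (by exact_mod_cast hN.ne')]
  have := Finset.card_eq_sum_card_fiberwise (f := s) (s := Finset.univ) (t := Finset.univ)
    (fun i _ => by simp)
  rw [Finset.card_univ, Fintype.card_fin] at this
  exact_mod_cast this.symm

theorem sum_comp_state {N : ℕ} (hN : 0 < N) (s : Fin N → S) (g : S → ℝ) :
    ∑ i, g (s i) = N * ∑ t, config s t * g t := by
  rw [← Finset.sum_fiberwise Finset.univ s, Finset.mul_sum]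
  refine Finset.sum_congr rfl fun t _ => ?_
  rw [Finset.sum_congr rfl (g := fun _ => g t), Finset.sum_const, nsmul_eq_mul,
    card_state_eq hN, mul_assoc]
  intro i hi
  rw [(Finset.mem_filter.1 hi).2]

/-- Given a global state and an action of the index policy, the mean of the next configuration is
the value of the mean-field map. -/
theorem mean_config_eq_meanFieldMap (B : RestlessBandit S) {ν : S → ℝ}
    (hν : Function.Injective ν) {α : ℝ} {N M : ℕ} (hN : 0 < N) (hM : (M : ℝ) = α * N)
    {s : Fin N → S} {a : Fin N → Fin 2} (ha : a ∈ indexActions ν M s) (t : S) :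
    (∑ i, B.P (a i) (s i) t) / N = B.meanFieldMap ν α (config s) t := by
  have hN' : (N : ℝ) ≠ 0 := by exact_mod_cast hN.ne'
  rw [div_eq_iff hN', RestlessBandit.meanFieldMap, Finset.sum_mul,
    ← Finset.sum_fiberwise Finset.univ s]
  refine Finset.sum_congr rfl fun u _ => ?_
  have hk := card_active_eq ν hν α hN hM s a ha u
  have h1 : ∀ i ∈ Finset.univ.filter (fun i => s i = u), B.P (a i) (s i) t
      = B.P 0 u t + (if a i = 1 then 1 else 0) * (B.P 1 u t - B.P 0 u t) := by
    intro i hi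
    rw [(Finset.mem_filter.1 hi).2]
    generalize a i = b
    fin_cases b <;> simp
  rw [Finset.sum_congr rfl h1, Finset.sum_add_distrib, ← Finset.sum_mul, Finset.sum_const,
    nsmul_eq_mul, card_state_eq hN, Finset.sum_boole, Finset.filter_filter, hk]
  ring

/-- Under the product kernel the indicators of `s' i = t` are independent, so their centered sum has
variance at most `N`; the normalization divides by `N ^ 2`. -/
theorem sum_kernel_mul_sq_config_sub_le (B : RestlessBandit S) {N : ℕ} (hN : 0 < N)
    (s : Fin N → S) (a : Fin N → Fin 2) (t : S) :
    ∑ s', B.kernel s a s' * (config s' t - (∑ i, B.P (a i) (s i) t) / N) ^ 2 ≤ 1 / N := by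
  have hN' : (0 : ℝ) < N := by exact_mod_cast hN
  have hp : ∀ i, ∑ u, B.P (a i) (s i) u = 1 :=
    fun i => sum_row_of_mem_rowStochastic (B.P_stochastic (a i)) (s i)
  have h := sum_prod_mul_sq_le (p := fun i u => B.P (a i) (s i) u)
    (f := fun i u => (if u = t then 1 else 0) - B.P (a i) (s i) t)
    (fun i u => nonneg_of_mem_rowStochastic (B.P_stochastic (a i))) hp
    (fun i => by simp [mul_sub, Finset.sum_sub_distrib, ← Finset.sum_mul, hp])
    (fun i u => by
      have h0 := nonneg_of_mem_rowStochastic (B.P_stochastic (a i)) (i := s i) (j := t)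
      have h1 := le_one_of_mem_rowStochastic (B.P_stochastic (a i)) (i := s i) (j := t)
      split_ifs <;> nlinarith)
  have heq : ∀ s' : Fin N → S, B.kernel s a s'
      * (config s' t - (∑ i, B.P (a i) (s i) t) / N) ^ 2
      = (∏ i, B.P (a i) (s i) (s' i))
        * (∑ i, ((if s' i = t then 1 else 0) - B.P (a i) (s i) t)) ^ 2 / N ^ 2 := fun s' => by
    rw [RestlessBandit.kernel, config, Finset.sum_sub_distrib, Finset.sum_boole, ← sub_div,
      div_pow, mul_div_assoc]
  simp only [heq]
  rw [← Finset.sum_div, div_le_div_iff₀ (by positivity) hN']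
  rw [Fintype.card_fin] at h
  nlinarith

theorem sum_kernel_mul_abs_config_sub_le (B : RestlessBandit S) {N : ℕ} (hN : 0 < N)
    (s : Fin N → S) (a : Fin N → Fin 2) (t : S) :
    ∑ s', B.kernel s a s' * |config s' t - (∑ i, B.P (a i) (s i) t) / N| ≤ 1 / √N := by
  have hN' : (0 : ℝ) < √N := Real.sqrt_pos.2 (by exact_mod_cast hN)
  have hsq : √(N : ℝ) ^ 2 = N := Real.sq_sqrt (Nat.cast_nonneg N)
  -- AM-GM in place of Cauchy-Schwarz, weighted so that a second moment of `1 / N` makes both terms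
  -- `1 / (2 * √N)`.
  have hle : ∀ v : ℝ, |v| ≤ √N / 2 * v ^ 2 + 1 / (2 * √N) := fun v => by
    rw [← sq_abs v]
    have : √N / 2 * |v| ^ 2 + 1 / (2 * √N) - |v| = (√N * |v| - 1) ^ 2 / (2 * √N) := by
      field_simp
      ring
    have : 0 ≤ (√N * |v| - 1) ^ 2 / (2 * √N) := by positivity
    linarith
  calc _ ≤ ∑ s', B.kernel s a s' * (√N / 2 * (config s' t - (∑ i, B.P (a i) (s i) t) / N) ^ 2
        + 1 / (2 * √N)) :=
        Finset.sum_le_sum fun s' _ => mul_le_mul_of_nonneg_left (hle _) (B.kernel_nonneg s a s')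
    _ = √N / 2 * ∑ s', B.kernel s a s' * (config s' t - (∑ i, B.P (a i) (s i) t) / N) ^ 2
        + 1 / (2 * √N) := by
        simp only [mul_add, Finset.sum_add_distrib, ← Finset.sum_mul, B.sum_kernel, one_mul]
        rw [Finset.mul_sum]
        congr 1
        exact Finset.sum_congr rfl fun s' _ => by ring
    _ ≤ √N / 2 * (1 / N) + 1 / (2 * √N) := by
        gcongr
        exact sum_kernel_mul_sq_config_sub_le B hN s a t
    _ = 1 / √N := by
        have : (N : ℝ) = √N * √N := by rw [← sq, hsq]
        rw [show (1 : ℝ) / N = 1 / (√N * √N) by rw [← this]]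
        field_simp
        norm_num

/-- In one step of the index policy the configuration deviates from the mean-field map by
`O(1 / √N)` on average. -/
theorem sum_kernel_mul_norm_config_sub_le (B : RestlessBandit S) {ν : S → ℝ}
    (hν : Function.Injective ν) {α : ℝ} {N M : ℕ} (hN : 0 < N) (hM : (M : ℝ) = α * N)
    {s : Fin N → S} {a : Fin N → Fin 2} (ha : a ∈ indexActions ν M s) :
    ∑ s', B.kernel s a s' * ‖config s' - B.meanFieldMap ν α (config s)‖
      ≤ Fintype.card S / √N := by
  have hle : ∀ s' : Fin N → S, ‖config s' - B.meanFieldMap ν α (config s)‖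
      ≤ ∑ t, |config s' t - (∑ i, B.P (a i) (s i) t) / N| := fun s' => by
    rw [pi_norm_le_iff_of_nonneg (Finset.sum_nonneg fun _ _ => abs_nonneg _)]
    intro t
    rw [Pi.sub_apply, ← mean_config_eq_meanFieldMap B hν hN hM ha, Real.norm_eq_abs]
    exact Finset.single_le_sum (f := fun t => |config s' t - (∑ i, B.P (a i) (s i) t) / N|)
      (fun _ _ => abs_nonneg _) (Finset.mem_univ t)
  calc _ ≤ ∑ s', B.kernel s a s' * ∑ t, |config s' t - (∑ i, B.P (a i) (s i) t) / N| :=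
        Finset.sum_le_sum fun s' _ => mul_le_mul_of_nonneg_left (hle _) (B.kernel_nonneg s a s')
    _ = ∑ t, ∑ s', B.kernel s a s' * |config s' t - (∑ i, B.P (a i) (s i) t) / N| := by
        simp only [Finset.mul_sum]
        rw [Finset.sum_comm]
    _ ≤ ∑ _t : S, 1 / √N :=
        Finset.sum_le_sum fun t _ => sum_kernel_mul_abs_config_sub_le B hN s a t
    _ = _ := by
        rw [Finset.sum_const, nsmul_eq_mul, Finset.card_univ, mul_one_div]

/-! ### Stationary averages -/

theorem indexPolicy_nonneg {S' : Type*} (ν : S' → ℝ) (M : ℕ) {N : ℕ} (s : Fin N → S')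
    (a : Fin N → Fin 2) : 0 ≤ indexPolicy ν M s a := by
  unfold indexPolicy
  split_ifs <;> positivity

/-- Stationarity in dual form, against test functions. -/
theorem RestlessBandit.IsStationary.sum_mul_eq {B : RestlessBandit S} {N : ℕ}
    {π : (Fin N → S) → (Fin N → Fin 2) → ℝ} {μ : (Fin N → S) → ℝ} (h : B.IsStationary π μ)
    (g : (Fin N → S) → ℝ) :
    ∑ s, ∑ a, μ s * π s a * ∑ s', B.kernel s a s' * g s' = ∑ s, μ s * g s := by
  have hμ : ∀ s', μ s' * g s' = (∑ s, ∑ a, μ s * π s a * B.kernel s a s') * g s' := fun s' => by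
    rw [h.2]
  rw [Finset.sum_congr rfl fun s' _ => hμ s']
  simp only [Finset.sum_mul, Finset.mul_sum]
  symm
  rw [Finset.sum_comm]
  refine Finset.sum_congr rfl fun s _ => ?_
  rw [Finset.sum_comm]
  exact Finset.sum_congr rfl fun a _ => Finset.sum_congr rfl fun s' _ => by ring

/-- The one-step bound is required only on the support of the policy, where the conditional mean of
the configuration is known. -/
theorem RestlessBandit.IsStationary.sum_mul_le {B : RestlessBandit S} {ν : S → ℝ} {N M : ℕ}
    (hMN : M ≤ N) {μ : (Fin N → S) → ℝ} (h : B.IsStationary (indexPolicy ν M) μ)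
    {g G : (Fin N → S) → ℝ}
    (hg : ∀ s, ∀ a ∈ indexActions ν M s, ∑ s', B.kernel s a s' * g s' ≤ G s) :
    ∑ s, μ s * g s ≤ ∑ s, μ s * G s := by
  rw [← h.sum_mul_eq]
  refine Finset.sum_le_sum fun s _ => ?_
  calc _ ≤ ∑ a, μ s * indexPolicy ν M s a * G s := Finset.sum_le_sum fun a _ => by
        by_cases ha : a ∈ indexActions ν M s
        · exact mul_le_mul_of_nonneg_left (hg s a ha)
            (mul_nonneg (h.1.1 s) (indexPolicy_nonneg ν M s a))
        · simp [indexPolicy, ha]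
    _ = μ s * G s := by
        rw [← Finset.sum_mul, ← Finset.mul_sum, sum_indexPolicy ν hMN s, mul_one]

/-- In stationarity the configuration is within `O(1 / √N)` of the attractor on average. -/
theorem exists_stationary_mean_norm_config_sub_le (B : RestlessBandit S) {ν : S → ℝ}
    (hν : Function.Injective ν) {α : ℝ} {mstar : S → ℝ}
    (hU : IsUniformGlobalAttractor (B.meanFieldMap ν α) mstar) (hnd : NonDegenerate ν α mstar) :
    ∃ C : ℝ, ∀ N M : ℕ, 0 < N → M ≤ N → (M : ℝ) = α * N →
      ∀ μ : (Fin N → S) → ℝ, B.IsStationary (indexPolicy ν M) μ →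
        ∑ s, μ s * ‖config s - mstar‖ ≤ C / √N := by
  obtain ⟨T, hT⟩ := B.exists_iterate_contracting hν hU hnd
  set φ := B.meanFieldMap ν α with hφ
  set L : ℝ := Fintype.card S * (2 * Fintype.card S + 1) with hL
  have hL0 : 0 ≤ L := by positivity
  have hlip : ∀ k m m', ‖φ^[k] m - φ^[k] m'‖ ≤ L ^ k * ‖m - m'‖ := by
    intro k
    induction k with
    | zero => simp
    | succ k ih =>
      intro m m'
      rw [Function.iterate_succ_apply', Function.iterate_succ_apply', pow_succ', mul_assoc]
      exact (B.norm_meanFieldMap_sub_le ν α _ _).trans (mul_le_mul_of_nonneg_left (ih m m') hL0)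
  -- The factor `2` absorbs the contracted half of the mean into the left side; `L ^ k` propagates a
  -- one-step fluctuation through `k` iterates.
  refine ⟨2 * ∑ k ∈ Finset.range T, L ^ k * Fintype.card S, fun N M hN hMN hM μ hμ => ?_⟩
  -- By stationarity `config s` may be replaced by the next configuration, which is close to `φ
  -- (config s)`.
  have hstep : ∀ k, ∑ s, μ s * ‖φ^[k] (config s) - mstar‖
      ≤ ∑ s, μ s * ‖φ^[k + 1] (config s) - mstar‖ + L ^ k * (Fintype.card S / √N) := by
    intro k
    have : ∑ s, μ s * ‖φ^[k + 1] (config s) - mstar‖ + L ^ k * (Fintype.card S / √N)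
        = ∑ s, μ s * (‖φ^[k + 1] (config s) - mstar‖ + L ^ k * (Fintype.card S / √N)) := by
      simp only [mul_add, Finset.sum_add_distrib, ← Finset.sum_mul, hμ.1.2, one_mul]
    rw [this]
    refine hμ.sum_mul_le hMN fun s a ha => ?_
    calc ∑ s', B.kernel s a s' * ‖φ^[k] (config s') - mstar‖
        ≤ ∑ s', B.kernel s a s' * (‖φ^[k + 1] (config s) - mstar‖
            + L ^ k * ‖config s' - φ (config s)‖) := by
          refine Finset.sum_le_sum fun s' _ =>
            mul_le_mul_of_nonneg_left ?_ (B.kernel_nonneg s a s')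
          have h1 := norm_sub_le_norm_sub_add_norm_sub (φ^[k] (config s'))
            (φ^[k] (φ (config s))) mstar
          have h2 := hlip k (config s') (φ (config s))
          rw [Function.iterate_succ_apply]
          linarith
      _ = ‖φ^[k + 1] (config s) - mstar‖
            + L ^ k * ∑ s', B.kernel s a s' * ‖config s' - φ (config s)‖ := by
          simp only [mul_add, Finset.sum_add_distrib, ← Finset.sum_mul, B.sum_kernel, one_mul]
          rw [Finset.mul_sum]
          congr 1
          exact Finset.sum_congr rfl fun s' _ => by ring
      _ ≤ _ := by
          gcongr
          exact sum_kernel_mul_norm_config_sub_le B hν hN hM ha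
  have hiter : ∀ k, ∑ s, μ s * ‖config s - mstar‖ ≤ ∑ s, μ s * ‖φ^[k] (config s) - mstar‖
      + ∑ j ∈ Finset.range k, L ^ j * (Fintype.card S / √N) := by
    intro k
    induction k with
    | zero => simp
    | succ k ih =>
      rw [Finset.sum_range_succ]
      linarith [hstep k]
  have hcontr : ∑ s, μ s * ‖φ^[T] (config s) - mstar‖
      ≤ 1 / 2 * ∑ s, μ s * ‖config s - mstar‖ := by
    rw [Finset.mul_sum]
    refine Finset.sum_le_sum fun s _ => ?_
    have := mul_le_mul_of_nonneg_left (hT _ (config_mem_stdSimplex hN s)) (hμ.1.1 s)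
    linarith
  have hsum : ∑ j ∈ Finset.range T, L ^ j * (Fintype.card S / √N)
      = (∑ j ∈ Finset.range T, L ^ j * Fintype.card S) / √N := by
    rw [Finset.sum_div]
    exact Finset.sum_congr rfl fun j _ => by ring
  have := hiter T
  rw [hsum] at this
  rw [mul_div_assoc]
  linarith

/-! ### Exchangeability of the agents -/

theorem comp_mem_indexActions_iff (ν : S → ℝ) (M : ℕ) {N : ℕ} (σ : Equiv.Perm (Fin N))
    (s : Fin N → S) (a : Fin N → Fin 2) :
    a ∘ σ ∈ indexActions ν M (s ∘ σ) ↔ a ∈ indexActions ν M s := by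
  classical
  have hcard : (Finset.univ.filter fun i => (a ∘ σ) i = 1).card
      = (Finset.univ.filter fun i => a i = 1).card := by
    rw [← Finset.card_map σ.toEmbedding]
    congr 1
    ext i
    simp [Finset.mem_map_equiv]
  simp only [indexActions, Finset.mem_filter, Finset.mem_univ, true_and, Function.comp_apply]
    at hcard ⊢
  rw [hcard]
  refine and_congr_right fun _ => ⟨fun h i j hi hj => ?_, fun h i j => h (σ i) (σ j)⟩
  have := h (σ.symm i) (σ.symm j)
  simp only [Equiv.apply_symm_apply] at this
  exact this hi hj

theorem indexPolicy_comp (ν : S → ℝ) (M : ℕ) {N : ℕ} (σ : Equiv.Perm (Fin N))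
    (s : Fin N → S) (a : Fin N → Fin 2) :
    indexPolicy ν M (s ∘ σ) (a ∘ σ) = indexPolicy ν M s a := by
  have hcard : (indexActions ν M (s ∘ σ)).card = (indexActions ν M s).card := by
    refine (Finset.card_bij (fun a _ => a ∘ σ)
      (fun a ha => (comp_mem_indexActions_iff ν M σ s a).2 ha)
      (fun a _ b _ h => σ.surjective.injective_comp_right h)
      fun b hb => ⟨b ∘ σ.symm, ?_, ?_⟩).symm
    · rw [← comp_mem_indexActions_iff ν M σ, Function.comp_assoc, Equiv.symm_comp_self]
      exact hb
    · rw [Function.comp_assoc, Equiv.symm_comp_self]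
      rfl
  simp only [indexPolicy, comp_mem_indexActions_iff, hcard]

theorem RestlessBandit.kernel_comp (B : RestlessBandit S) {N : ℕ} (σ : Equiv.Perm (Fin N))
    (s : Fin N → S) (a : Fin N → Fin 2) (s' : Fin N → S) :
    B.kernel (s ∘ σ) (a ∘ σ) (s' ∘ σ) = B.kernel s a s' :=
  Equiv.prod_comp σ fun i => B.P (a i) (s i) (s' i)

theorem sum_comp_perm {N : ℕ} {κ : Type*} [Fintype κ] (σ : Equiv.Perm (Fin N))
    (g : (Fin N → κ) → ℝ) : ∑ x, g (x ∘ σ) = ∑ x, g x :=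
  Equiv.sum_comp (Equiv.arrowCongr σ.symm (Equiv.refl κ)) g

/-- Kernel and policy are permutation invariant, so a relabelled stationary distribution is again
stationary; uniqueness identifies the two. -/
theorem RestlessBandit.IsUniqueStationary.comp_perm {B : RestlessBandit S} {ν : S → ℝ} {N M : ℕ}
    {μ : (Fin N → S) → ℝ} (h : B.IsUniqueStationary (indexPolicy ν M) μ)
    (σ : Equiv.Perm (Fin N)) (s : Fin N → S) : μ (s ∘ σ) = μ s := by
  refine congrFun (h.2 (fun s => μ (s ∘ σ)) ⟨⟨fun s => h.1.1.1 _, ?_⟩, fun s' => ?_⟩) s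
  · rw [sum_comp_perm σ μ, h.1.1.2]
  · beta_reduce
    rw [← h.1.2 (s' ∘ σ)]
    symm
    rw [← sum_comp_perm σ]
    refine Finset.sum_congr rfl fun s _ => ?_
    rw [← sum_comp_perm σ]
    refine Finset.sum_congr rfl fun a _ => ?_
    rw [indexPolicy_comp, B.kernel_comp]

theorem config_comp {N : ℕ} (σ : Equiv.Perm (Fin N)) (s : Fin N → S) :
    config (s ∘ σ) = config s := by
  ext t
  simp only [config]
  congr 2
  rw [← Finset.card_map σ.toEmbedding]
  congr 1
  ext i
  simp [Finset.mem_map_equiv]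

/-- Under the unique stationary distribution, the local state of one agent is distributed as the
configuration. -/
theorem RestlessBandit.IsUniqueStationary.sum_mul_config_apply {B : RestlessBandit S} {ν : S → ℝ}
    {N M : ℕ} {μ : (Fin N → S) → ℝ} (h : B.IsUniqueStationary (indexPolicy ν M) μ)
    (D : (S → ℝ) → S → ℝ) (i : Fin N) :
    ∑ s, μ s * D (config s) (s i) = ∑ s, μ s * ∑ t, config s t * D (config s) t := by
  have hN : 0 < N := i.pos
  have hN' : (N : ℝ) ≠ 0 := by exact_mod_cast hN.ne'
  have hij : ∀ j, ∑ s, μ s * D (config s) (s j) = ∑ s, μ s * D (config s) (s i) := by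
    intro j
    rw [← sum_comp_perm (Equiv.swap i j)]
    refine Finset.sum_congr rfl fun s _ => ?_
    rw [h.comp_perm, config_comp, Function.comp_apply, Equiv.swap_apply_right]
  have hsum : ∑ j : Fin N, ∑ s, μ s * D (config s) (s j)
      = N * ∑ s, μ s * D (config s) (s i) := by
    rw [Finset.sum_congr rfl fun j _ => hij j]
    simp
  refine mul_left_cancel₀ hN' ?_
  rw [← hsum, Finset.sum_comm, Finset.mul_sum]
  refine Finset.sum_congr rfl fun s _ => ?_
  rw [← Finset.mul_sum, sum_comp_state hN]
  ring

/-- Swapping two agents in the same local state fixes `s` and exchanges their actions. -/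
theorem sum_indexPolicy_mul_apply_eq (ν : S → ℝ) (M : ℕ) {N : ℕ} (s : Fin N → S) (g : Fin 2 → ℝ)
    {i j : Fin N} (hij : s i = s j) :
    ∑ a, indexPolicy ν M s a * g (a j) = ∑ a, indexPolicy ν M s a * g (a i) := by
  rw [← sum_comp_perm (Equiv.swap i j)]
  refine Finset.sum_congr rfl fun a _ => ?_
  have hs : s ∘ Equiv.swap i j = s := by
    ext k
    rw [Function.comp_apply, Equiv.swap_apply_def]
    split_ifs with h1 h2
    · rw [h1, hij]
    · rw [h2, hij]
    · rfl
  nth_rewrite 1 [← hs]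
  rw [indexPolicy_comp, Function.comp_apply, Equiv.swap_apply_right]

/-- The probability that the index policy activates a given agent. -/
theorem sum_indexPolicy_mul_boole {ν : S → ℝ} (hν : Function.Injective ν) {α : ℝ} {N M : ℕ}
    (hMN : M ≤ N) (hM : (M : ℝ) = α * N) (s : Fin N → S) (i : Fin N) :
    ∑ a, indexPolicy ν M s a * (if a i = 1 then 1 else 0)
      = activated ν α (config s) (s i) / config s (s i) := by
  have hN : 0 < N := i.pos
  have hN' : (0 : ℝ) < N := by exact_mod_cast hN
  set n := (Finset.univ.filter fun j => s j = s i).card with hn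
  have hn0 : (0 : ℝ) < n := by
    exact_mod_cast Finset.card_pos.2 ⟨i, by simp⟩
  have hnc : (n : ℝ) = N * config s (s i) := card_state_eq hN s (s i)
  -- The expected number of active agents in the state of `i` is computed twice: by symmetry among
  -- those agents (`h1`), and from the deterministic count (`h2`).
  have h1 : ∑ j ∈ Finset.univ.filter (fun j => s j = s i),
      ∑ a, indexPolicy ν M s a * (if a j = 1 then 1 else 0)
      = n * ∑ a, indexPolicy ν M s a * (if a i = 1 then 1 else 0) := by
    rw [Finset.sum_congr rfl fun j hj => sum_indexPolicy_mul_apply_eq ν M s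
      (fun b => if b = 1 then 1 else 0) (Finset.mem_filter.1 hj).2.symm]
    rw [Finset.sum_const, nsmul_eq_mul]
  have h2 : ∑ j ∈ Finset.univ.filter (fun j => s j = s i),
      ∑ a, indexPolicy ν M s a * (if a j = 1 then 1 else 0)
      = N * activated ν α (config s) (s i) := by
    rw [Finset.sum_comm]
    have : ∀ a, ∑ j ∈ Finset.univ.filter (fun j => s j = s i),
        indexPolicy ν M s a * (if a j = 1 then 1 else 0)
        = indexPolicy ν M s a * (N * activated ν α (config s) (s i)) := by
      intro a
      by_cases ha : a ∈ indexActions ν M s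
      · rw [← Finset.mul_sum, Finset.sum_boole, Finset.filter_filter,
          card_active_eq ν hν α hN hM s a ha]
      · simp [indexPolicy, ha]
    simp only [this]
    rw [← Finset.sum_mul, sum_indexPolicy ν hMN s, one_mul]
  rw [h2] at h1
  have hc : config s (s i) ≠ 0 := by
    rintro h
    rw [hnc, h, mul_zero] at hn0
    exact lt_irrefl _ hn0
  rw [eq_div_iff hc]
  refine mul_left_cancel₀ hN'.ne' ?_
  rw [h1, hnc]
  ring

/-- The action of a given agent under the index policy is distributed according to the local policy
under the current configuration. -/
theorem sum_indexPolicy_mul_apply {ν : S → ℝ} (hν : Function.Injective ν) {α : ℝ} {N M : ℕ}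
    (hMN : M ≤ N) (hM : (M : ℝ) = α * N) (s : Fin N → S) (i : Fin N) (g : Fin 2 → ℝ) :
    ∑ a, indexPolicy ν M s a * g (a i) = ∑ b, localPolicy ν α (config s) (s i) b * g b := by
  have hg : ∀ b : Fin 2, g b = g 0 + (if b = 1 then 1 else 0) * (g 1 - g 0) := by
    intro b
    fin_cases b <;> simp
  have h : ∀ a : Fin N → Fin 2, indexPolicy ν M s a * g (a i) = indexPolicy ν M s a * g 0
      + indexPolicy ν M s a * (if a i = 1 then 1 else 0) * (g 1 - g 0) := fun a => by
    rw [hg (a i)]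
    ring
  simp only [h]
  rw [Finset.sum_add_distrib, ← Finset.sum_mul, ← Finset.sum_mul, sum_indexPolicy ν hMN s,
    sum_indexPolicy_mul_boole hν hMN hM, Fin.sum_univ_two]
  simp only [localPolicy, Fin.isValue, zero_ne_one, if_false, if_true]
  ring

/-! ### The local policy -/

theorem localPolicy_nonneg (ν : S → ℝ) (α : ℝ) {m : S → ℝ} {t : S} (hm : 0 ≤ m t) (a : Fin 2) :
    0 ≤ localPolicy ν α m t a := by
  unfold localPolicy
  split_ifs
  · exact div_nonneg (activated_nonneg ν α hm) hm
  · exact sub_nonneg.2 (div_le_one_of_le₀ (activated_le ν α m t) hm)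

theorem sum_localPolicy (ν : S → ℝ) (α : ℝ) (m : S → ℝ) (t : S) :
    ∑ a, localPolicy ν α m t a = 1 := by
  rw [Fin.sum_univ_two]
  simp [localPolicy]

/-- The activation probability is a quotient by `m t`, badly behaved near `m t = 0`; the weight `m
t` turns it into the Lipschitz activated mass. -/
theorem mul_abs_localPolicy_sub_le (ν : S → ℝ) (α : ℝ) {m m' : S → ℝ} {t : S} (hm : 0 ≤ m t)
    (hm' : 0 ≤ m' t) :
    m t * |localPolicy ν α m t 1 - localPolicy ν α m' t 1|
      ≤ (Fintype.card S + 1) * ‖m - m'‖ := by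
  -- Also valid at `m t = 0`, where the activated mass vanishes.
  have h1 : m t * localPolicy ν α m t 1 = activated ν α m t := by
    simp only [localPolicy, if_true]
    refine mul_div_cancel_of_imp' fun h => le_antisymm ?_ (activated_nonneg ν α hm)
    exact (activated_le ν α m t).trans h.le
  have h2 : m' t * localPolicy ν α m' t 1 = activated ν α m' t := by
    simp only [localPolicy, if_true]
    refine mul_div_cancel_of_imp' fun h => le_antisymm ?_ (activated_nonneg ν α hm')
    exact (activated_le ν α m' t).trans h.le
  have h3 := localPolicy_nonneg ν α hm' 1
  have h4 : localPolicy ν α m' t 1 ≤ 1 := by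
    have := sum_localPolicy ν α m' t
    rw [Fin.sum_univ_two] at this
    linarith [localPolicy_nonneg ν α hm' 0]
  have hd : |m t - m' t| ≤ ‖m - m'‖ := norm_le_pi_norm (m - m') t
  calc m t * |localPolicy ν α m t 1 - localPolicy ν α m' t 1|
      = |(activated ν α m t - activated ν α m' t)
          - (m t - m' t) * localPolicy ν α m' t 1| := by
        rw [← h1, ← h2]
        nth_rewrite 1 [← abs_of_nonneg hm]
        rw [← abs_mul]
        congr 1
        ring
    _ ≤ |activated ν α m t - activated ν α m' t| + |m t - m' t| * |localPolicy ν α m' t 1| := by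
        rw [← abs_mul]; exact abs_sub _ _
    _ ≤ Fintype.card S * ‖m - m'‖ + ‖m - m'‖ * 1 := by
        gcongr
        · exact abs_activated_sub_le ν α m m' t
        · rwa [abs_of_nonneg h3]
    _ = _ := by ring

/-! ### The product of the local chains -/

/-- The transition matrix on local state-action pairs of a single agent that follows the local
policy `q`. -/
def RestlessBandit.localMatrix (B : RestlessBandit S) (q : S → Fin 2 → ℝ) :
    Matrix (S × Fin 2) (S × Fin 2) ℝ :=
  Matrix.of fun z z' => B.P z.2 z.1 z'.1 * q z'.1 z'.2

theorem RestlessBandit.localMatrix_mem_rowStochastic (B : RestlessBandit S) {q : S → Fin 2 → ℝ}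
    (hq0 : ∀ t a, 0 ≤ q t a) (hq : ∀ t, ∑ a, q t a = 1) :
    B.localMatrix q ∈ rowStochastic ℝ (S × Fin 2) := by
  rw [mem_rowStochastic_iff_sum]
  refine ⟨fun z z' => mul_nonneg (nonneg_of_mem_rowStochastic (B.P_stochastic _)) (hq0 _ _),
    fun z => ?_⟩
  rw [Fintype.sum_prod_type]
  simp only [localMatrix, of_apply, ← Finset.mul_sum, hq, mul_one]
  exact sum_row_of_mem_rowStochastic (B.P_stochastic _) _

theorem tensor_mem_separable {N : ℕ} {Q : Fin N → Matrix (S × Fin 2) (S × Fin 2) ℝ}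
    (hQ : ∀ i, Q i ∈ rowStochastic ℝ (S × Fin 2)) : tensor Q ∈ separable S N :=
  ⟨fun z z' => show 0 ≤ ∏ i, Q i (z i) (z' i) from
      Finset.prod_nonneg fun i _ => nonneg_of_mem_rowStochastic (hQ i),
    1, fun _ => 1, fun _ => Q, one_pos, by simp, fun _ => hQ, by simp⟩

theorem sum_pair {N : ℕ} (f : (Fin N → S) → (Fin N → Fin 2) → ℝ) :
    ∑ z : Pair S N, f z.state z.action = ∑ s, ∑ a, f s a := by
  rw [← Fintype.sum_prod_type']
  exact Equiv.sum_comp (Equiv.arrowProdEquivProdArrow (Fin N) (fun _ => S) fun _ => Fin 2)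
    fun p : (Fin N → S) × (Fin N → Fin 2) => f p.1 p.2

/-- Both matrices share the state kernel and differ only in the law of the next actions given `s'`;
the actions of the other agents sum out. -/
theorem inducedMatrix_sub_tensor_mulVec (B : RestlessBandit S) {ν : S → ℝ}
    (hν : Function.Injective ν) {α : ℝ} {N M : ℕ} (hMN : M ≤ N) (hM : (M : ℝ) = α * N)
    {q : S → Fin 2 → ℝ} (hq : ∀ t, ∑ a, q t a = 1) (i : Fin N) (x : S × Fin 2 → ℝ)
    (z : Pair S N) :
    ((B.inducedMatrix (indexPolicy ν M) - tensor fun _ => B.localMatrix q)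
        *ᵥ fun z => x (z i)) z
      = ∑ s', B.kernel z.state z.action s'
        * ∑ b, (localPolicy ν α (config s') (s' i) b - q (s' i) b) * x (s' i, b) := by
  have h1 : ∀ z' : Pair S N,
      (B.inducedMatrix (indexPolicy ν M) - tensor fun _ => B.localMatrix q :
          Matrix (Pair S N) (Pair S N) ℝ) z z' * x (z' i)
        = B.kernel z.state z.action z'.state
          * (indexPolicy ν M z'.state z'.action * x (z'.state i, z'.action i)
            - (∏ j, q (z'.state j) (z'.action j)) * x (z'.state i, z'.action i)) := fun z' => by
    simp only [Matrix.sub_apply, RestlessBandit.inducedMatrix, tensor, RestlessBandit.localMatrix,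
      of_apply, Finset.prod_mul_distrib]
    simp only [RestlessBandit.kernel, Pair.state, Pair.action]
    ring
  rw [mulVec, dotProduct, Finset.sum_congr rfl fun z' _ => h1 z',
    sum_pair fun s' a' => B.kernel z.state z.action s' * (indexPolicy ν M s' a' * x (s' i, a' i)
      - (∏ j, q (s' j) (a' j)) * x (s' i, a' i))]
  refine Finset.sum_congr rfl fun s' _ => ?_
  rw [← Finset.mul_sum, Finset.sum_sub_distrib,
    sum_indexPolicy_mul_apply hν hMN hM s' i fun b => x (s' i, b),
    sum_prod_mul_apply (p := fun j => q (s' j)) (fun j => hq (s' j)) i fun b => x (s' i, b),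
    ← Finset.sum_sub_distrib]
  simp only [sub_mul]

theorem abs_sum_localPolicy_sub_mul_le (ν : S → ℝ) (α : ℝ) (m m' : S → ℝ) (t : S)
    {x : S × Fin 2 → ℝ} (hx : ‖x‖ = 1) :
    |∑ b, (localPolicy ν α m t b - localPolicy ν α m' t b) * x (t, b)|
      ≤ 2 * |localPolicy ν α m t 1 - localPolicy ν α m' t 1| := by
  have hx' : ∀ b, |x (t, b)| ≤ 1 := fun b => hx ▸ norm_le_pi_norm x (t, b)
  have h : ∀ m : S → ℝ, localPolicy ν α m t 0 = 1 - localPolicy ν α m t 1 := fun m => by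
    simp [localPolicy]
  rw [Fin.sum_univ_two, h, h]
  calc _ = |localPolicy ν α m t 1 - localPolicy ν α m' t 1| * |x (t, 1) - x (t, 0)| := by
        rw [← abs_mul]; congr 1; ring
    _ ≤ |localPolicy ν α m t 1 - localPolicy ν α m' t 1| * 2 := by
        gcongr
        exact (abs_sub _ _).trans (by linarith [hx' 0, hx' 1])
    _ = _ := mul_comm _ _

theorem entanglement_le {N : ℕ} {μ : Pair S N → ℝ} (hμ : ∀ z, 0 ≤ μ z) (i : Fin N)
    (P : Matrix (Pair S N) (Pair S N) ℝ) {Q : Matrix (Pair S N) (Pair S N) ℝ}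
    (hQ : Q ∈ separable S N) {c : ℝ} (hc : 0 ≤ c)
    (h : ∀ x : S × Fin 2 → ℝ, ‖x‖ = 1 → weightedNorm μ ((P - Q) *ᵥ fun z => x (z i)) ≤ 2 * c) :
    entanglement μ i P ≤ c := by
  -- A real `sInf` bounds its elements from below only for sets bounded below; here `0` serves
  -- because the weights are nonnegative.
  have hbdd : BddBelow (weightedATV μ i P '' separable S N) := by
    refine ⟨0, ?_⟩
    rintro _ ⟨Q', -, rfl⟩
    refine mul_nonneg (by norm_num) (Real.iSup_nonneg fun x => ?_)
    exact Finset.sum_nonneg fun z _ => mul_nonneg (hμ z) (abs_nonneg _)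
  refine (csInf_le hbdd ⟨Q, hQ, rfl⟩).trans ?_
  have : ⨆ x : {x : S × Fin 2 → ℝ // ‖x‖ = 1},
      weightedNorm μ ((P - Q) *ᵥ fun z => x.1 (z i)) ≤ 2 * c :=
    Real.iSup_le (fun x => h x.1 x.2) (by linarith)
  unfold weightedATV
  linarith

/-- The Markov entanglement of the index policy is bounded by the stationary mean distance of the
configuration from any fixed configuration. -/
theorem entanglement_indexPolicy_le (B : RestlessBandit S) {ν : S → ℝ}
    (hν : Function.Injective ν) {α : ℝ} {m' : S → ℝ} (hm' : m' ∈ stdSimplex ℝ S) {N M : ℕ}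
    (hMN : M ≤ N) (hM : (M : ℝ) = α * N) {μ : (Fin N → S) → ℝ}
    (hμ : B.IsUniqueStationary (indexPolicy ν M) μ) (i : Fin N) :
    entanglement (occupancy (indexPolicy ν M) μ) i (B.inducedMatrix (indexPolicy ν M))
      ≤ Fintype.card S * (Fintype.card S + 1) * ∑ s, μ s * ‖config s - m'‖ := by
  have hN : 0 < N := i.pos
  have hμ0 := hμ.1.1.1
  set D : (S → ℝ) → S → ℝ := fun m t => |localPolicy ν α m t 1 - localPolicy ν α m' t 1| with hD
  refine entanglement_le (fun z => mul_nonneg (hμ0 _) (indexPolicy_nonneg ν M _ _)) i _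
    (tensor_mem_separable fun _ => B.localMatrix_mem_rowStochastic
      (fun t => localPolicy_nonneg ν α (hm'.1 t)) (sum_localPolicy ν α m'))
    (mul_nonneg (by positivity)
      (Finset.sum_nonneg fun s _ => mul_nonneg (hμ0 s) (norm_nonneg _))) fun x hx => ?_
  calc _ ≤ ∑ z : Pair S N, μ z.state * indexPolicy ν M z.state z.action
          * ∑ s', B.kernel z.state z.action s' * (2 * D (config s') (s' i)) := by
        refine Finset.sum_le_sum fun z _ => mul_le_mul_of_nonneg_left ?_
          (mul_nonneg (hμ0 _) (indexPolicy_nonneg ν M _ _))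
        rw [inducedMatrix_sub_tensor_mulVec B hν hMN hM (sum_localPolicy ν α m')]
        refine (Finset.abs_sum_le_sum_abs _ _).trans (Finset.sum_le_sum fun s' _ => ?_)
        rw [abs_mul, abs_of_nonneg (B.kernel_nonneg _ _ _)]
        exact mul_le_mul_of_nonneg_left (abs_sum_localPolicy_sub_mul_le ν α _ _ _ hx)
          (B.kernel_nonneg _ _ _)
    _ = ∑ s, μ s * (2 * D (config s) (s i)) := by
        rw [sum_pair fun s a => μ s * indexPolicy ν M s a
          * ∑ s', B.kernel s a s' * (2 * D (config s') (s' i))]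
        exact hμ.1.sum_mul_eq fun s' => 2 * D (config s') (s' i)
    -- Exchangeability supplies the weight `config s t` that the Lipschitz estimate for the local
    -- policy needs.
    _ = 2 * ∑ s, μ s * ∑ t, config s t * D (config s) t := by
        rw [← hμ.sum_mul_config_apply D i, Finset.mul_sum]
        exact Finset.sum_congr rfl fun s _ => by ring
    _ ≤ 2 * ∑ s, μ s * (Fintype.card S * (Fintype.card S + 1) * ‖config s - m'‖) := by
        refine mul_le_mul_of_nonneg_left (Finset.sum_le_sum fun s _ =>
          mul_le_mul_of_nonneg_left ?_ (hμ0 s)) (by norm_num)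
        refine (Finset.sum_le_card_nsmul _ _ _ fun t _ => mul_abs_localPolicy_sub_le ν α
          ((config_mem_stdSimplex hN s).1 t) (hm'.1 t)).trans ?_
        rw [nsmul_eq_mul, Finset.card_univ, mul_assoc]
    _ = _ := by
        rw [Finset.mul_sum (a := (Fintype.card S * (Fintype.card S + 1) : ℝ))]
        congr 1
        exact Finset.sum_congr rfl fun s _ => by ring

end RMAB

end

/-! ### The rate and asymptotic separability -/

theorem mainTheorem3 {S : Type*} [Fintype S] [DecidableEq S] (B : RMAB.RestlessBandit S)
    (ν : S → ℝ) (hν : Function.Injective ν) (α : ℝ) (hα : α ∈ Set.Icc (0 : ℝ) 1)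
    (mstar : S → ℝ)
    (hUGAP : RMAB.IsUniformGlobalAttractor (B.meanFieldMap ν α) mstar)
    (hnd : RMAB.NonDegenerate ν α mstar) :
    (∃ C : ℝ, ∀ N M : ℕ, 0 < N → (M : ℝ) = α * N →
      ∀ μ : (Fin N → S) → ℝ, B.IsUniqueStationary (RMAB.indexPolicy ν M) μ →
      ∀ i : Fin N,
        RMAB.entanglement (RMAB.occupancy (RMAB.indexPolicy ν M) μ) i
          (B.inducedMatrix (RMAB.indexPolicy ν M)) ≤ C / Real.sqrt N) ∧
    (∀ ε : ℝ, 0 < ε → ∃ N₀ : ℕ, ∀ N M : ℕ, N₀ ≤ N → (M : ℝ) = α * N →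
      ∀ μ : (Fin N → S) → ℝ, B.IsUniqueStationary (RMAB.indexPolicy ν M) μ →
      ∀ i : Fin N,
        RMAB.entanglement (RMAB.occupancy (RMAB.indexPolicy ν M) μ) i
          (B.inducedMatrix (RMAB.indexPolicy ν M)) ≤ ε) := by
  -- The rate implies the limit statement, so only the rate remains.
  refine (and_iff_left_of_imp ?_).2 ?_
  · rintro ⟨C, hC⟩ ε hε
    have ht : Filter.Tendsto (fun N : ℕ => C / √(N : ℝ)) Filter.atTop (nhds 0) :=
      Filter.Tendsto.const_div_atTop
        (Real.tendsto_sqrt_atTop.comp tendsto_natCast_atTop_atTop) C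
    obtain ⟨N₀, hN₀⟩ := Filter.eventually_atTop.1 (ht.eventually_lt_const hε)
    exact ⟨N₀, fun N M hN hM μ hμ i => (hC N M i.pos hM μ hμ i).trans (hN₀ N hN).le⟩
  · obtain ⟨C, hC⟩ := RMAB.exists_stationary_mean_norm_config_sub_le B hν hUGAP hnd
    refine ⟨Fintype.card S * (Fintype.card S + 1) * C, fun N M hN hM μ hμ i => ?_⟩
    have hMN : M ≤ N := by
      have : (M : ℝ) ≤ N := hM ▸ mul_le_of_le_one_left (Nat.cast_nonneg N) hα.2
      exact_mod_cast this
    refine (RMAB.entanglement_indexPolicy_le B hν hUGAP.1 hMN hM hμ i).trans ?_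
    rw [mul_div_assoc]
    exact mul_le_mul_of_nonneg_left (hC N M hN hMN hM μ hμ.1) (by positivity)
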